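/- Let $A<B$, let $p,k\ge 1$, let $\Theta\subset\mathbb R^p$ and let $\eta:[A,B]\times\Theta\to\mathbb R$ be continuous and differentiable in $\theta$; fix $\theta\in\Theta$. A design is a probability measure on $[A,B]$ with finite support. Its index $I(\xi)$ is the number of its support points, where $A$ and $B$ are counted by $1/2$ only. Its information matrix is $M(\xi,\theta)=\int \frac{\partial\eta}{\partial\theta}(x,\theta)\bigl(\frac{\partial\eta}{\partial\theta}(x,\theta)\bigr)^T d\xi(x)$. Symmetric matrices are compared in the Loewner order: $M_1\le M_2$ means that $M_2-M_1$ is positive semidefinite. Suppose that there are a nonsingular $p\times p$ matrix $P$ and functions $\Psi_{ij}:[A,B]\to\mathbb R$ $(1\le i,j\le p)$ such that $M(\xi,\theta)=P\,\bigl(\int\Psi_{ij}\,d\xi\bigr)_{i,j}\,P^T$ for every design $\xi$. Let $\Psi_1,\dots,\Psi_k$ be the pairwise different non-constant functions among the $\Psi_{ij}$, numbered so that for some $l$ we have $\Psi_k=\Psi_{ll}$ and $\Psi_{ij}\ne\Psi_k$ for all $(i,j)\ne(l,l)$. Put $\Psi_0=1$. Assume that $\Psi_j$ is $(j+1)$ times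 continuously differentiable on $[A,B]$ for $j=1,\dots,k$. Define $w_0=1$ and $w_{j+1}=D_jD_{j-1}\cdots D_0\Psi_{j+1}$ for $j=0,\dots,k-1$, where $D_jf=(f/w_j)'$, with one-sided derivatives at $A$ and $B$; it is assumed that all derivatives occurring in these definitions exist on $[A,B]$. Suppose that $F(x)=w_1(x)\cdots w_k(x)\ne0$ for all $x\in[A,B]$. Then for every design $\xi$ there is a design $\tilde\xi$ with $I(\tilde\xi)\le k/2$ and $M(\tilde\xi,\theta)\ge M(\xi,\theta)$ such that the following holds. If $I(\xi)<k/2$, then $\tilde\xi=\xi$, and $\xi$ is the only design $\zeta$ with $\int\Psi_i\,d\zeta=\int\Psi_i\,d\xi$ for $i=0,\dots,k-1$. If $I(\xi)\ge k/2$, then: (1a) if $k$ is odd and $F<0$ on $[A,B]$, then $\tilde\xi$ has at most $(k+1)/2$ support points, and $A$ is one of them; (1b) if $k$ is odd and $F>0$ on $[A,B]$, then $\tilde\xi$ has at most $(k+1)/2$ support points, and $B$ is one of them; (2a) if $k$ is even and $F<0$ on $[A,B]$, then $\tilde\xi$ has at most $k/2$ support points; (2b) if $k$ is even and $F>0$ on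 $[A,B]$, then $\tilde\xi$ has at most $k/2+1$ support points, and $A$ and $B$ are among them. -/

import Mathlib

open MeasureTheory Set

noncomputable section

namespace OptimalDesign

/-- A design on `[A, B]`: a probability measure whose mass sits on a finite subset of `[A, B]`. -/
structure IsDesign (A B : ℝ) (ξ : Measure ℝ) : Prop where
  prob : IsProbabilityMeasure ξ
  finite_support : ∃ s : Finset ℝ, (s : Set ℝ) ⊆ Icc A B ∧ ξ ((s : Set ℝ)ᶜ) = 0

/-- The support points of a design: the points of positive mass. -/
def supportPoints (ξ : Measure ℝ) : Set ℝ := {x | ξ {x} ≠ 0}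

/-- The index of a design on `[A, B]`: the number of support points, the boundary points
`A` and `B` being counted by `1/2` only. -/
def index (A B : ℝ) (ξ : Measure ℝ) : ℝ :=
  ((supportPoints ξ \ {A, B}).ncard : ℝ) + ((supportPoints ξ ∩ {A, B}).ncard : ℝ) / 2

/-- The `i`-th partial derivative of the regression function `η(x, θ)` in the parameter
`θ ∈ Θ` (relative to the parameter set `Θ`). -/
def partialDeriv {p : ℕ} (Θ : Set (EuclideanSpace ℝ (Fin p)))
    (η : ℝ → EuclideanSpace ℝ (Fin p) → ℝ) (θ : EuclideanSpace ℝ (Fin p))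
    (i : Fin p) (x : ℝ) : ℝ :=
  fderivWithin ℝ (η x) Θ θ (EuclideanSpace.single i 1)

/-- The information matrix `M(ξ, θ) = ∫ (∂η/∂θ) (∂η/∂θ)ᵀ dξ`. -/
def infoMatrix {p : ℕ} (Θ : Set (EuclideanSpace ℝ (Fin p)))
    (η : ℝ → EuclideanSpace ℝ (Fin p) → ℝ) (θ : EuclideanSpace ℝ (Fin p))
    (ξ : Measure ℝ) : Matrix (Fin p) (Fin p) ℝ :=
  Matrix.of fun i j => ∫ x, partialDeriv Θ η θ i x * partialDeriv Θ η θ j x ∂ξ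

/-- The matrix `C(ξ)` with entries `∫ Ψ_{ij} dξ`. -/
def momentMatrix {p : ℕ} (Ψm : Fin p → Fin p → ℝ → ℝ) (ξ : Measure ℝ) :
    Matrix (Fin p) (Fin p) ℝ :=
  Matrix.of fun i j => ∫ x, Ψm i j x ∂ξ

/-- `f` is a constant function on `S`. -/
def IsConstOn (f : ℝ → ℝ) (S : Set ℝ) : Prop := ∃ c : ℝ, ∀ x ∈ S, f x = c

/-- `Ψ 1, …, Ψ k` are the different functions on `[A, B]` among the entries `Ψm i j` that are
not constant on `[A, B]`, each listed exactly once. -/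
structure IsListOfNonconstantEntries (A B : ℝ) (k : ℕ) (Ψ : ℕ → ℝ → ℝ) {p : ℕ}
    (Ψm : Fin p → Fin p → ℝ → ℝ) : Prop where
  nonconst : ∀ m ∈ Icc 1 k, ¬ IsConstOn (Ψ m) (Icc A B)
  distinct : ∀ m ∈ Icc 1 k, ∀ n ∈ Icc 1 k, EqOn (Ψ m) (Ψ n) (Icc A B) → m = n
  entry : ∀ m ∈ Icc 1 k, ∃ i j, EqOn (Ψm i j) (Ψ m) (Icc A B)
  exhaust : ∀ i j, ¬ IsConstOn (Ψm i j) (Icc A B) →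
    ∃ m ∈ Icc 1 k, EqOn (Ψm i j) (Ψ m) (Icc A B)

/-- The last function `Ψ k` is a diagonal entry `Ψm l l`, and occurs nowhere else in the matrix. -/
def LastIsDiagonal (A B : ℝ) (k : ℕ) (Ψ : ℕ → ℝ → ℝ) {p : ℕ}
    (Ψm : Fin p → Fin p → ℝ → ℝ) : Prop :=
  ∃ l, EqOn (Ψm l l) (Ψ k) (Icc A B) ∧
    ∀ i j, (i, j) ≠ (l, l) → ¬ EqOn (Ψm i j) (Ψ k) (Icc A B)

/-- The operator `f ↦ (f / v)'` on the interval `[A, B]` (one-sided derivatives at the ends). -/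
def quotDeriv (A B : ℝ) (v f : ℝ → ℝ) : ℝ → ℝ :=
  fun x => derivWithin (fun t => f t / v t) (Icc A B) x

/-- `iterD A B Ψ j m = D_{j-1} ⋯ D_0 Ψ_m`, where `D_i f = (f / w_i)'` and
`w_i = D_{i-1} ⋯ D_0 Ψ_i` is the diagonal entry `iterD A B Ψ i i`. -/
def iterD (A B : ℝ) (Ψ : ℕ → ℝ → ℝ) : ℕ → ℕ → ℝ → ℝ
  | 0, m => Ψ m
  | j + 1, m => quotDeriv A B (iterD A B Ψ j j) (iterD A B Ψ j m)

/-- The functions `w_0 = Ψ_0` (which is `1` when `Ψ_0 = 1`) and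
`w_{j+1} = D_j ⋯ D_0 Ψ_{j+1}`. -/
def wFun (A B : ℝ) (Ψ : ℕ → ℝ → ℝ) (j : ℕ) : ℝ → ℝ := iterD A B Ψ j j

/-- All derivatives that occur in the definition of `w_1, …, w_k` exist on `[A, B]`: for
`i ≤ j < k` the function `(D_{i-1} ⋯ D_0 Ψ_{j+1}) / w_i`, to which `d/dx` is applied, is
differentiable on `[A, B]`. -/
def DerivativesExist (A B : ℝ) (k : ℕ) (Ψ : ℕ → ℝ → ℝ) : Prop :=
  ∀ j < k, ∀ i ≤ j,
    DifferentiableOn ℝ (fun t => iterD A B Ψ i (j + 1) t / wFun A B Ψ i t) (Icc A B)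

/-- `F = w_1 ⋯ w_k`. -/
def prodW (A B : ℝ) (k : ℕ) (Ψ : ℕ → ℝ → ℝ) (x : ℝ) : ℝ :=
  ∏ j ∈ Finset.Icc 1 k, wFun A B Ψ j x

end OptimalDesign

end

/-! Each `w_j` with `j ≥ 1` is a derivative without zeros, so by Darboux it has a constant sign.
Repeatedly dividing by `w_m`, subtracting neighbouring rows and applying the mean value theorem then
fixes the signs of the determinants `det (Ψ_i (x_j))`: `Ψ_0, …, Ψ_n` is a Chebyshev system for every
`n ≤ k` (`det_iterD_pos`). Hence on `k + 1` ordered points the annihilator of `Ψ_0, …, Ψ_{k-1}`,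
normalized to be positive on `Ψ_k`, alternates strictly in sign, and its sign at the largest point
is that of `F` (`exists_alternating_weights`). Any nonzero finitely supported annihilator has `k`
sign changes (`exists_sign_changes`).

The improved design maximizes `∫ Ψ_k` among the designs sharing the moments of `ξ` up to `k - 1`; it
exists because the convex hull of a compact curve is compact. Only the `(l, l)` entry of the moment
matrix changes, and it does not decrease, which gives the Loewner inequality.

The index of the maximizer is bounded from both sides. If all negative points of an alternating
annihilator carried mass, adding a small multiple of it would increase `∫ Ψ_k`; interlacing support
points with midpoints turns this into an upper bound (`card_le_of_maximal`). Conversely, two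
different designs with equal moments differ by an annihilator with `k` sign changes, whose negative
points lie in the support of the subtracted design, so each has index at least `k / 2`
(`le_index_of_ne`). For `I(ξ) ≥ k / 2` both bounds apply, and parity decides which end points are
present. -/

noncomputable section

namespace OptimalDesign

/-! ### Determinants and the mean value theorem -/

section Determinants

/-- Mean value theorem for a linear functional of a vector of functions. -/
lemma exists_linearMap_slope {n : ℕ} {A B a b : ℝ} (hab : a < b) (ha : a ∈ Icc A B)
    (hb : b ∈ Icc A B) (f : Fin n → ℝ → ℝ) (hf : ∀ i, DifferentiableOn ℝ (f i) (Icc A B))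
    (L : (Fin n → ℝ) →ₗ[ℝ] ℝ) :
    ∃ c ∈ Ioo a b, L (fun i => f i b - f i a)
      = (b - a) * L (fun i => derivWithin (f i) (Icc A B) c) := by
  have hL : ∀ v : Fin n → ℝ, L v = ∑ i, v i * L (Pi.single i 1) := fun v => by
    conv_lhs => rw [pi_eq_sum_univ' v]
    simp [map_sum]
  obtain ⟨c, hc, h⟩ := exists_hasDerivAt_eq_slope (fun t => ∑ i, f i t * L (Pi.single i 1))
    (fun t => ∑ i, derivWithin (f i) (Icc A B) t * L (Pi.single i 1)) hab
    (continuousOn_finsetSum _ fun i _ =>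
      (((hf i).continuousOn.mono (Icc_subset_Icc ha.1 hb.2)).mul continuousOn_const))
    (fun x hx => by
      refine HasDerivAt.fun_sum fun i _ => HasDerivAt.mul_const ?_ _
      have hx' : x ∈ Icc A B := ⟨ha.1.trans hx.1.le, hx.2.le.trans hb.2⟩
      exact ((hf i x hx').hasDerivWithinAt).hasDerivAt
        (Icc_mem_nhds (ha.1.trans_lt hx.1) (hx.2.trans_le hb.2)))
  refine ⟨c, hc, ?_⟩
  rw [hL, hL (fun i => derivWithin (f i) (Icc A B) c), h]
  have : b - a ≠ 0 := sub_ne_zero.2 hab.ne'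
  field_simp
  rw [← Finset.sum_sub_distrib]
  exact Finset.sum_congr rfl fun i _ => by ring

/-- A determinant of increments equals, up to the lengths of the intervals, a determinant of
derivatives at intermediate points. -/
lemma exists_det_slope {n : ℕ} {A B : ℝ} (a b : Fin n → ℝ) (hab : ∀ j, a j < b j)
    (ha : ∀ j, a j ∈ Icc A B) (hb : ∀ j, b j ∈ Icc A B)
    (f : Fin n → ℝ → ℝ) (hf : ∀ i, DifferentiableOn ℝ (f i) (Icc A B)) :
    ∃ c : Fin n → ℝ, (∀ j, c j ∈ Ioo (a j) (b j)) ∧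
      (Matrix.of fun j i => f i (b j) - f i (a j)).det
        = (∏ j, (b j - a j)) *
          (Matrix.of fun j i => derivWithin (f i) (Icc A B) (c j)).det := by
  classical
  have key : ∀ S : Finset (Fin n), ∃ c : Fin n → ℝ, (∀ j, c j ∈ Ioo (a j) (b j)) ∧
      (Matrix.of fun j i => f i (b j) - f i (a j)).det
        = (∏ j ∈ S, (b j - a j)) *
          (Matrix.of fun j i => if j ∈ S then derivWithin (f i) (Icc A B) (c j)
            else f i (b j) - f i (a j)).det := by
    intro S
    induction S using Finset.induction_on with
    | empty => exact ⟨fun j => (a j + b j) / 2,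
        fun j => ⟨by linarith [hab j], by linarith [hab j]⟩, by simp⟩
    | insert j S hj ih =>
      obtain ⟨c, hc, h⟩ := ih
      set N : Matrix (Fin n) (Fin n) ℝ := Matrix.of fun j i =>
        if j ∈ S then derivWithin (f i) (Icc A B) (c j) else f i (b j) - f i (a j) with hN
      -- With the other rows frozen the determinant is a linear functional of row `j`, so one scalar
      -- mean value theorem treats the whole row with a single point `t`.
      obtain ⟨t, ht, hL⟩ := exists_linearMap_slope (hab j) (ha j) (hb j) f hf
        ((Matrix.detRowAlternating (n := Fin n) (R := ℝ)).toMultilinearMap.toLinearMap N j)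
      refine ⟨Function.update c j t, fun i => ?_, ?_⟩
      · by_cases hi : i = j
        · subst hi; simpa using ht
        · simpa [Function.update_of_ne hi] using hc i
      · rw [h, Finset.prod_insert hj, mul_comm (b j - a j), mul_assoc]
        congr 1
        have h1 : N = N.updateRow j (fun i => f i (b j) - f i (a j)) := by
          ext l i
          by_cases hl : l = j
          · subst hl; simp [hN, hj]
          · simp [Matrix.updateRow_ne hl]
        have h2 : (Matrix.of fun l i => if l ∈ insert j S then
            derivWithin (f i) (Icc A B) (Function.update c j t l)
            else f i (b l) - f i (a l)) =
            N.updateRow j (fun i => derivWithin (f i) (Icc A B) t) := by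
          ext l i
          by_cases hl : l = j
          · subst hl; simp
          · simp [hN, hl]
        rw [h2]
        conv_lhs => rw [h1]
        exact hL
  obtain ⟨c, hc, h⟩ := key Finset.univ
  exact ⟨c, hc, by simpa using h⟩

/-- Subtracting consecutive rows in a matrix whose first column is constantly one. -/
lemma det_eq_det_sub_of_col_one {n : ℕ} (M : Matrix (Fin (n + 1)) (Fin (n + 1)) ℝ)
    (h : ∀ j, M j 0 = 1) :
    M.det = (Matrix.of fun (j i : Fin n) => M j.succ i.succ - M j.castSucc i.succ).det := by
  let N : Matrix (Fin (n + 1)) (Fin (n + 1)) ℝ :=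
    Matrix.of (Fin.cons (M 0) fun j i => M j.succ i - M j.castSucc i)
  have hMN : M.det = N.det :=
    Matrix.det_eq_of_forall_row_eq_smul_add_pred (fun _ => 1) (fun j => by simp [N])
      (fun i j => by simp [N])
  rw [hMN, Matrix.det_succ_column_zero, Fin.sum_univ_succ]
  have h0 : ∀ i : Fin n, N i.succ 0 = 0 := fun i => by simp [N, h]
  have h1 : N 0 0 = 1 := by simp [N, h]
  simp only [h0, h1]
  simp only [Fin.val_zero, pow_zero, mul_one, one_mul, mul_zero, zero_mul, Finset.sum_const_zero,
    add_zero]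
  congr 1

end Determinants

/-! ### Chebyshev systems and alternating annihilators -/

/-- The signs `s j` of the functions `w_j` determine the signs of the generalized Vandermonde
determinants. -/
lemma det_iterD_pos {A B : ℝ} {k : ℕ} {Ψ : ℕ → ℝ → ℝ} (hD : DerivativesExist A B k Ψ)
    (s : ℕ → ℝ) (hs : ∀ j ≤ k, ∀ x ∈ Icc A B, 0 < s j * wFun A B Ψ j x) (n : ℕ) :
    ∀ m, m + n ≤ k → ∀ x : Fin (n + 1) → ℝ, StrictMono x → (∀ j, x j ∈ Icc A B) →
      0 < (∏ j ∈ Finset.range (n + 1), s (m + j) ^ (n + 1 - j)) *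
        (Matrix.of fun (j i : Fin (n + 1)) => iterD A B Ψ m (m + i) (x j)).det := by
  induction n with
  | zero =>
    intro m hm x _ hxI
    simpa [wFun] using hs m (by omega) (x 0) (hxI 0)
  | succ n ih =>
    intro m hm x hx hxI
    have hw : ∀ j, wFun A B Ψ m (x j) ≠ 0 := fun j h => by
      have := hs m (by omega) (x j) (hxI j); simp [h] at this
    -- Dividing row `j` by `w_m (x_j)` makes the first column constantly one; row differences then
    -- lower the size by one.
    have h1 : (Matrix.of fun (j i : Fin (n + 2)) => iterD A B Ψ m (m + i) (x j)).det =
        (∏ j, wFun A B Ψ m (x j)) * (Matrix.of fun (j i : Fin (n + 1)) =>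
          iterD A B Ψ m (m + i.succ) (x j.succ) / wFun A B Ψ m (x j.succ) -
          iterD A B Ψ m (m + i.succ) (x j.castSucc) / wFun A B Ψ m (x j.castSucc)).det := by
      let Q : Matrix (Fin (n + 2)) (Fin (n + 2)) ℝ :=
        Matrix.of fun j i => iterD A B Ψ m (m + i) (x j) / wFun A B Ψ m (x j)
      have hQ : (Matrix.of fun (j i : Fin (n + 2)) => iterD A B Ψ m (m + i) (x j)) =
          Matrix.of fun (j i : Fin (n + 2)) => wFun A B Ψ m (x j) * Q j i := by
        ext j i; simp only [Matrix.of_apply, Q]; field_simp [hw j]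
      rw [hQ, Matrix.det_mul_column, det_eq_det_sub_of_col_one Q fun j => div_self (hw j)]
      rfl
    obtain ⟨c, hc, h⟩ := exists_det_slope (n := n + 1) (A := A) (B := B)
      (fun j => x j.castSucc) (fun j => x j.succ)
      (fun j => hx Fin.castSucc_lt_succ) (fun j => hxI _) (fun j => hxI _)
      (fun i t => iterD A B Ψ m (m + i.succ) t / wFun A B Ψ m t)
      (fun i => by simpa [add_assoc] using hD (m + i) (by omega) m (by omega))
    -- The intermediate points lie in consecutive open intervals, so they are again ordered and the
    -- induction hypothesis applies at level `m + 1`.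
    have hcm : StrictMono c := by
      refine Fin.strictMono_iff_lt_succ.2 fun i => ?_
      exact (hc i.castSucc).2.trans_le ((hx.monotone (by simp)).trans
        (hc i.succ).1.le)
    have hcI : ∀ j, c j ∈ Icc A B := fun j =>
      ⟨(hxI _).1.trans (hc j).1.le, (hc j).2.le.trans (hxI _).2⟩
    have hih := ih (m + 1) (by omega) c hcm hcI
    have h2 : (Matrix.of fun (j i : Fin (n + 1)) => iterD A B Ψ (m + 1) (m + 1 + i) (c j)) =
        Matrix.of fun (j i : Fin (n + 1)) => derivWithin
          (fun t => iterD A B Ψ m (m + i.succ) t / wFun A B Ψ m t) (Icc A B) (c j) := by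
      ext j i
      simp only [Matrix.of_apply, iterD, quotDeriv, Fin.val_succ, wFun,
        show m + 1 + (i : ℕ) = m + (i + 1) by omega]
    rw [h2] at hih
    rw [h1, h, Finset.prod_range_succ']
    have h3 : 0 < s m ^ (n + 2) * ∏ j, wFun A B Ψ m (x j) := by
      have : s m ^ (n + 2) * ∏ j, wFun A B Ψ m (x j) = ∏ j, s m * wFun A B Ψ m (x j) := by
        rw [Finset.prod_mul_distrib]; simp
      rw [this]
      exact Finset.prod_pos fun j _ => hs m (by omega) _ (hxI j)
    have h4 : 0 < ∏ j : Fin (n + 1), (x j.succ - x j.castSucc) :=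
      Finset.prod_pos fun j _ => sub_pos.2 (hx Fin.castSucc_lt_succ)
    have h5 : ∀ j, s (m + (j + 1)) ^ (n + 1 + 1 - (j + 1)) = s (m + 1 + j) ^ (n + 1 - j) :=
      fun j => by rw [show m + (j + 1) = m + 1 + j by omega]; congr 1; omega
    simp only [h5]
    refine (mul_pos (mul_pos h3 h4) hih).trans_eq ?_
    simp only [add_zero, Nat.sub_zero]
    ring

/-- On `k + 1` ordered points there are weights of alternating signs that annihilate
`Ψ 0, …, Ψ (k - 1)` and give a positive value on `Ψ k`; their signs are governed by the sign
`e` of `w_0 ⋯ w_k`. -/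
lemma exists_alternating_weights {A B : ℝ} {k : ℕ} {Ψ : ℕ → ℝ → ℝ}
    (hD : DerivativesExist A B k Ψ) (hk : 1 ≤ k)
    (s : ℕ → ℝ) (hs : ∀ j ≤ k, ∀ x ∈ Icc A B, 0 < s j * wFun A B Ψ j x)
    (x : Fin (k + 1) → ℝ) (hx : StrictMono x) (hxI : ∀ j, x j ∈ Icc A B) :
    ∃ τ : Fin (k + 1) → ℝ,
      (∀ j : Fin (k + 1), 0 < (-1) ^ ((j : ℕ) + k) * (∏ i ∈ Finset.range (k + 1), s i) * τ j) ∧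
      (∀ i < k, ∑ j, τ j * Ψ i (x j) = 0) ∧ 0 < ∑ j, τ j * Ψ k (x j) := by
  set E := ∏ j ∈ Finset.range (k + 1), s j ^ (k + 1 - j) with hE
  let minor : Fin (k + 1) → ℝ := fun j =>
    (Matrix.of fun (l i : Fin k) => Ψ i (x (j.succAbove l))).det
  -- Laplace expansion along the last column: `g = Ψ i` with `i < k` repeats a column, while `g = Ψ
  -- k` gives the full determinant.
  have hdet : ∀ g : ℝ → ℝ, ∑ j : Fin (k + 1), ((-1) ^ ((j : ℕ) + k) * minor j) * g (x j) =
      (Matrix.of fun (j i : Fin (k + 1)) => if i = Fin.last k then g (x j) else Ψ i (x j)).det := by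
    intro g
    rw [Matrix.det_succ_column _ (Fin.last k)]
    refine Finset.sum_congr rfl fun j _ => ?_
    have : (Matrix.of fun (j i : Fin (k + 1)) =>
        if i = Fin.last k then g (x j) else Ψ i (x j)).submatrix j.succAbove
          (Fin.last k).succAbove = Matrix.of fun (l i : Fin k) => Ψ i (x (j.succAbove l)) := by
      ext l i
      simp [Fin.castSucc_ne_last]
    rw [this]
    simp only [Matrix.of_apply, if_true, Fin.val_last, minor]
    ring
  refine ⟨fun j => E * ((-1) ^ ((j : ℕ) + k) * minor j), fun j => ?_, fun i hi => ?_, ?_⟩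
  · obtain ⟨n, rfl⟩ : ∃ n, k = n + 1 := ⟨k - 1, by omega⟩
    have h1 := det_iterD_pos hD s hs n 0 (by omega) (x ∘ j.succAbove)
      (hx.comp (Fin.strictMono_succAbove j)) fun l => hxI _
    simp only [zero_add, iterD, Function.comp_apply] at h1
    have h2 : 0 < ∏ i ∈ Finset.range (n + 1 + 1), s i ^ 2 := by
      refine Finset.prod_pos fun i hi => ?_
      have hi' : i ≤ n + 1 := by simpa [Nat.lt_succ_iff] using hi
      have := hs i hi' _ (hxI 0)
      have h0 : s i ≠ 0 := fun h => by simp [h] at this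
      positivity
    -- The sign factors of the full determinant and of its minors differ by exactly one `s i` for
    -- each `i`, so up to a square only `∏ s i` remains.
    have h3 : E = (∏ i ∈ Finset.range (n + 1 + 1), s i) *
        ∏ i ∈ Finset.range (n + 1), s i ^ (n + 1 - i) := by
      rw [hE, Finset.prod_range_succ, Finset.prod_range_succ _ (n + 1)]
      have : ∀ i ∈ Finset.range (n + 1), s i ^ (n + 1 + 1 - i) = s i * s i ^ (n + 1 - i) := by
        intro i hi
        rw [← pow_succ', Nat.sub_add_comm (by simp at hi; omega)]
      rw [Finset.prod_congr rfl this, Finset.prod_mul_distrib]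
      simp
      ring
    have h4 : ((-1 : ℝ) ^ ((j : ℕ) + (n + 1))) * (-1) ^ ((j : ℕ) + (n + 1)) = 1 := by
      rw [← mul_pow]; simp
    refine (mul_pos h2 h1).trans_eq ?_
    rw [h3, Finset.prod_pow]
    change _ * (_ * minor j) = _
    linear_combination (-(∏ i ∈ Finset.range (n + 1 + 1), s i) ^ 2 *
      (∏ i ∈ Finset.range (n + 1), s i ^ (n + 1 - i)) * minor j) * h4
  · simp only [mul_assoc, ← Finset.mul_sum]
    simp only [← mul_assoc ((-1 : ℝ) ^ _), hdet]
    rw [Matrix.det_zero_of_column_eq (i := ⟨i, by omega⟩) (j := Fin.last k), mul_zero]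
    · simp [Fin.ext_iff]; omega
    · intro j
      have : (⟨i, by omega⟩ : Fin (k + 1)) ≠ Fin.last k := by simp [Fin.ext_iff]; omega
      simp [this]
  · simp only [mul_assoc, ← Finset.mul_sum]
    simp only [← mul_assoc ((-1 : ℝ) ^ _), hdet]
    have h1 := det_iterD_pos hD s hs k 0 (by omega) x hx hxI
    simp only [zero_add, iterD] at h1
    convert h1 using 3
    ext j i
    simp only [Matrix.of_apply]
    split_ifs with h
    · subst h; simp
    · rfl

/-- Weights on at most `k` points that annihilate `Ψ 0, …, Ψ (k - 1)` vanish. -/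
lemma eq_zero_of_card_le {A B : ℝ} {k : ℕ} {Ψ : ℕ → ℝ → ℝ}
    (hD : DerivativesExist A B k Ψ)
    (s : ℕ → ℝ) (hs : ∀ j ≤ k, ∀ x ∈ Icc A B, 0 < s j * wFun A B Ψ j x)
    (σ : ℝ →₀ ℝ) (hσ : ∀ x ∈ σ.support, x ∈ Icc A B) (hcard : σ.support.card ≤ k)
    (h0 : ∀ i < k, Finsupp.linearCombination ℝ (Ψ i) σ = 0) : σ = 0 := by
  by_contra hne
  obtain ⟨n, hn⟩ : ∃ n, σ.support.card = n + 1 :=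
    ⟨σ.support.card - 1, by have := Finset.card_pos.2 (Finsupp.support_nonempty_iff.2 hne); omega⟩
  let x := σ.support.orderEmbOfFin hn
  have hdet := det_iterD_pos hD s hs n 0 (by omega) x x.strictMono
    fun j => hσ _ (Finset.orderEmbOfFin_mem _ hn j)
  have hv : Matrix.vecMul (fun j => σ (x j))
      (Matrix.of fun (j i : Fin (n + 1)) => iterD A B Ψ 0 (0 + i) (x j)) = 0 := by
    ext i
    have := h0 i (by omega)
    rw [Finsupp.linearCombination_apply, Finsupp.sum,
      ← Finset.map_orderEmbOfFin_univ σ.support hn, Finset.sum_map] at this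
    simpa [Matrix.vecMul, dotProduct, iterD] using this
  have h1 := Matrix.eq_zero_of_vecMul_eq_zero (right_ne_zero_of_mul hdet.ne') hv
  exact Finsupp.mem_support_iff.1 (Finset.orderEmbOfFin_mem _ hn 0) (congr_fun h1 0)

/-- Finitely supported signed weights on `[A, B]` that annihilate `Ψ 0, …, Ψ (k - 1)` have `k`
sign changes. -/
lemma exists_sign_changes {A B : ℝ} {k : ℕ} {Ψ : ℕ → ℝ → ℝ}
    (hD : DerivativesExist A B k Ψ) (hk : 1 ≤ k)
    (s : ℕ → ℝ) (hs : ∀ j ≤ k, ∀ x ∈ Icc A B, 0 < s j * wFun A B Ψ j x) (n : ℕ) :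
    ∀ σ : ℝ →₀ ℝ, σ.support.card ≤ n → (∀ x ∈ σ.support, x ∈ Icc A B) → σ ≠ 0 →
      (∀ i < k, Finsupp.linearCombination ℝ (Ψ i) σ = 0) →
      ∃ x : Fin (k + 1) → ℝ, StrictMono x ∧ (∀ j, x j ∈ Icc A B) ∧
        ((∀ j : Fin (k + 1), 0 < (-1) ^ (j : ℕ) * σ (x j)) ∨ ∀ j : Fin (k + 1), (-1) ^ (j : ℕ) * σ (x j) < 0) := by
  induction n with
  | zero => intro σ h _ h0; simp_all
  | succ n ih =>
    intro σ hn hI hne h0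
    have hcard : k + 1 ≤ σ.support.card := by
      by_contra h
      exact hne (eq_zero_of_card_le hD s hs σ hI (by omega) h0)
    obtain ⟨T, hT, hTc⟩ := Finset.exists_subset_card_eq hcard
    let x := T.orderEmbOfFin hTc
    have hxσ : ∀ j, x j ∈ σ.support := fun j => hT (Finset.orderEmbOfFin_mem _ hTc j)
    obtain ⟨τ, hτ, hτ0, -⟩ := exists_alternating_weights hD hk s hs x x.strictMono
      fun j => hI _ (hxσ j)
    by_cases hpat : (∀ j : Fin (k + 1), 0 < (-1) ^ (j : ℕ) * σ (x j)) ∨ ∀ j : Fin (k + 1), (-1) ^ (j : ℕ) * σ (x j) < 0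
    · exact ⟨x, x.strictMono, fun j => hI _ (hxσ j), hpat⟩
    have hτne : ∀ j, τ j ≠ 0 := fun j h => by have := hτ j; simp [h] at this
    -- If all quotients had the same sign, `σ` would alternate on these points as `τ` does.
    obtain ⟨⟨a, ha⟩, b, hb⟩ : (∃ j, 0 < σ (x j) / τ j) ∧ ∃ j, σ (x j) / τ j < 0 := by
      set c := (-1 : ℝ) ^ k * ∏ i ∈ Finset.range (k + 1), s i with hc
      have hτ' : ∀ j : Fin (k + 1), 0 < c * ((-1) ^ (j : ℕ) * τ j) := fun j => by
        convert hτ j using 1; rw [hc, pow_add]; ring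
      have hprod : ∀ j : Fin (k + 1), c * ((-1) ^ (j : ℕ) * σ (x j)) =
          (σ (x j) / τ j) * (c * ((-1) ^ (j : ℕ) * τ j)) := fun j => by
        field_simp [hτne j]
      have hquot : ∀ j, σ (x j) / τ j ≠ 0 := fun j =>
        div_ne_zero (Finsupp.mem_support_iff.1 (hxσ j)) (hτne j)
      have hc0 : c ≠ 0 := left_ne_zero_of_mul (hτ' 0).ne'
      push Not at hpat
      obtain ⟨⟨i, hi⟩, j, hj⟩ := hpat
      by_contra hcon
      rw [not_and_or] at hcon
      push Not at hcon
      rcases hcon with hcon | hcon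
      · have hneg : ∀ j : Fin (k + 1), c * ((-1) ^ (j : ℕ) * σ (x j)) < 0 := fun j => by
          rw [hprod]
          exact mul_neg_of_neg_of_pos (lt_of_le_of_ne (hcon j) (hquot j)) (hτ' j)
        rcases lt_or_gt_of_ne hc0 with h | h
        · nlinarith [hneg i]
        · nlinarith [hneg j]
      · have hpos : ∀ j : Fin (k + 1), 0 < c * ((-1) ^ (j : ℕ) * σ (x j)) := fun j => by
          rw [hprod]
          exact mul_pos (lt_of_le_of_ne (hcon j) (hquot j).symm) (hτ' j)
        rcases lt_or_gt_of_ne hc0 with h | h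
        · nlinarith [hpos j]
        · nlinarith [hpos i]
    -- Subtracting `t τ` with the least positive quotient `t` removes the point `x m`, reverses no
    -- sign, and keeps `x b`, where the quotient is negative. The support shrinks, so induction
    -- applies, and its sign pattern is inherited by `σ`.
    obtain ⟨m, hm, hmin⟩ := Finset.exists_min_image
      (Finset.univ.filter fun j => 0 < σ (x j) / τ j) (fun j => σ (x j) / τ j) ⟨a, by simpa using ha⟩
    simp only [Finset.mem_filter, Finset.mem_univ, true_and] at hm hmin
    set t := σ (x m) / τ m with ht
    let ρ : ℝ →₀ ℝ := ∑ j, Finsupp.single (x j) (τ j)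
    have hρx : ∀ j, ρ (x j) = τ j := fun j => by
      simp [ρ, Finsupp.finsetSum_apply, Finsupp.single_apply, x.injective.eq_iff]
    have hρ0 : ∀ y, (∀ j, x j ≠ y) → ρ y = 0 := fun y hy => by
      simp [ρ, Finsupp.finsetSum_apply, hy]
    let σ' := σ - t • ρ
    have hσ'x : ∀ j, σ' (x j) = (1 - t / (σ (x j) / τ j)) * σ (x j) := fun j => by
      have := Finsupp.mem_support_iff.1 (hxσ j)
      have := hτne j
      simp only [σ', Finsupp.sub_apply, Finsupp.smul_apply, hρx, smul_eq_mul]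
      field_simp
    have hconf : ∀ y, ∃ c : ℝ, 0 ≤ c ∧ σ' y = c * σ y := by
      intro y
      by_cases hy : ∃ j, x j = y
      · obtain ⟨j, rfl⟩ := hy
        refine ⟨_, ?_, hσ'x j⟩
        rcases le_or_gt (σ (x j) / τ j) 0 with h | h
        · have := div_nonpos_of_nonneg_of_nonpos hm.le h
          linarith
        · have := (div_le_one h).2 (hmin j h)
          linarith
      · push Not at hy
        exact ⟨1, zero_le_one, by simp [σ', hρ0 y hy]⟩
    have hsub : σ'.support ⊆ σ.support := fun y hy => by
      obtain ⟨c, -, hc⟩ := hconf y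
      rw [Finsupp.mem_support_iff] at hy ⊢
      intro h; simp [hc, h] at hy
    have hlt : σ'.support.card < σ.support.card := by
      refine Finset.card_lt_card ⟨hsub, fun h => ?_⟩
      have := h (hxσ m)
      rw [Finsupp.mem_support_iff, hσ'x m, ← ht, div_self hm.ne'] at this
      simp at this
    have hne' : σ' ≠ 0 := fun h => by
      have h1 := hσ'x b
      have h2 : t / (σ (x b) / τ b) < 0 := div_neg_of_pos_of_neg hm hb
      rw [h, Finsupp.zero_apply, eq_comm, mul_eq_zero] at h1
      rcases h1 with h1 | h1
      · linarith
      · exact Finsupp.mem_support_iff.1 (hxσ b) h1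
    obtain ⟨z, hz, hzI, hzs⟩ := ih σ' (by omega) (fun y hy => hI y (hsub hy)) hne' (fun i hi => by
      have : Finsupp.linearCombination ℝ (Ψ i) ρ = 0 := by
        simpa [ρ, map_sum, Finsupp.linearCombination_single] using hτ0 i hi
      simp [σ', map_sub, map_smul, h0 i hi, this])
    refine ⟨z, hz, hzI, hzs.imp (fun h j => ?_) (fun h j => ?_)⟩
    · obtain ⟨c, hc0, hc⟩ := hconf (z j)
      have := h j
      rw [hc] at this
      by_contra hcon
      nlinarith
    · obtain ⟨c, hc0, hc⟩ := hconf (z j)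
      have := h j
      rw [hc] at this
      by_contra hcon
      nlinarith

/-! ### Compactness of convex hulls -/

lemma sum_eq_sum_of_embedding {ι κ F : Type*} [Fintype ι] [Fintype κ] [AddCommMonoid F]
    (f : ι ↪ κ) (g : ι → F) (h : κ → F) (h1 : ∀ i, h (f i) = g i)
    (h2 : ∀ i, (¬ ∃ a, f a = i) → h i = 0) : ∑ i, h i = ∑ i, g i := by
  rw [← Finset.sum_subset (Finset.subset_univ (Finset.univ.map f)), Finset.sum_map]
  · exact Finset.sum_congr rfl fun i _ => h1 i
  · intro i _ hi
    exact h2 i (by simpa using hi)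

/-- In finite dimension the convex hull of a compact set is compact (Carathéodory). -/
lemma isCompact_convexHull_of_finiteDimensional {E : Type*} [AddCommGroup E] [Module ℝ E]
    [TopologicalSpace E] [ContinuousAdd E] [ContinuousSMul ℝ E] [FiniteDimensional ℝ E]
    {K : Set E} (hK : IsCompact K) : IsCompact (convexHull ℝ K) := by
  rcases K.eq_empty_or_nonempty with rfl | ⟨q, hq⟩
  · simp
  let N := Module.finrank ℝ E + 1
  have himg : convexHull ℝ K = (fun p : (Fin N → ℝ) × (Fin N → E) => ∑ i, p.1 i • p.2 i) ''
      (stdSimplex ℝ (Fin N) ×ˢ Set.univ.pi fun _ => K) := by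
    ext y
    constructor
    · intro hy
      obtain ⟨ι, _, z, w, hz, hind, hw, hw1, hwy⟩ := eq_pos_convex_span_of_mem_convexHull hy
      have hcard : Fintype.card ι ≤ Fintype.card (Fin N) := by
        simpa [N] using hind.card_le_finrank_succ.trans
          (Nat.succ_le_succ (Submodule.finrank_le _))
      obtain ⟨f⟩ := Function.Embedding.nonempty_of_card_le hcard
      -- Carathéodory may need fewer than `N` points; the spare slots receive weight `0` at the
      -- arbitrary point `q` of `K`.
      refine ⟨(Function.extend f w 0, Function.extend f z fun _ => q),
        ⟨⟨fun i => ?_, by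
          rw [← hw1]
          exact sum_eq_sum_of_embedding f _ _ (fun i => f.injective.extend_apply _ _ _)
            fun i hi => Function.extend_apply' _ _ _ hi⟩, fun i _ => ?_⟩, ?_⟩
      · by_cases hi : ∃ a, f a = i
        · obtain ⟨a, rfl⟩ := hi
          simpa [f.injective.extend_apply] using (hw a).le
        · simp [Function.extend_apply' _ _ _ hi]
      · by_cases hi : ∃ a, f a = i
        · obtain ⟨a, rfl⟩ := hi
          simpa [f.injective.extend_apply] using hz ⟨a, rfl⟩
        · simpa [Function.extend_apply' _ _ _ hi] using hq
      · rw [← hwy]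
        refine sum_eq_sum_of_embedding f _ _ (fun i => ?_) fun i hi => ?_
        · simp [f.injective.extend_apply]
        · simp [Function.extend_apply' _ _ _ hi]
    · rintro ⟨⟨w, z⟩, ⟨hw, hz⟩, rfl⟩
      exact (convex_convexHull ℝ K).sum_mem (fun i _ => hw.1 i) hw.2
        fun i _ => subset_convexHull ℝ K (hz i trivial)
  rw [himg]
  refine ((isCompact_stdSimplex ℝ (Fin N)).prod (isCompact_univ_pi fun _ => hK)).image ?_
  fun_prop

/-! ### Designs as finitely supported weights, and the maximal design -/

/-- A design is the sum of its point masses. -/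
lemma IsDesign.exists_weights {A B : ℝ} {ξ : Measure ℝ} (hξ : IsDesign A B ξ) :
    ∃ σ : ℝ →₀ ℝ, (∀ x, σ x = ξ.real {x}) ∧ (∀ x ∈ σ.support, x ∈ Icc A B) ∧
      ξ = ∑ x ∈ σ.support, ENNReal.ofReal (σ x) • Measure.dirac x := by
  have := hξ.prob
  obtain ⟨s, hs, h0⟩ := hξ.finite_support
  have hsupp : ∀ x, ξ.real {x} ≠ 0 → x ∈ s := fun x hx => by
    by_contra h
    refine hx ?_
    rw [Measure.real, measure_mono_null (by simpa using h) h0, ENNReal.toReal_zero]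
  let σ : ℝ →₀ ℝ := Finsupp.onFinset s (fun x => ξ.real {x}) hsupp
  refine ⟨σ, fun x => rfl, fun x hx => hs (hsupp x (Finsupp.mem_support_iff.1 hx)), ?_⟩
  have hof : ∀ x, ENNReal.ofReal (σ x) = ξ {x} := fun x => by simp [σ]
  rw [Finset.sum_subset (Finsupp.support_onFinset_subset : σ.support ⊆ s) (fun x _ hx => by
    have hx : σ x = 0 := Finsupp.notMem_support_iff.1 hx
    simp [hx])]
  classical
  ext E hE
  have h1 : ξ E = ξ ((s.filter (· ∈ E) : Finset ℝ) : Set ℝ) := by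
    rw [← measure_inter_add_sdiff E s.measurableSet,
      measure_mono_null (s := E \ s) (fun x hx => hx.2) h0, add_zero]
    congr 1
    ext x; simp [and_comm]
  rw [h1, ← sum_measure_singleton, Finset.sum_filter]
  simp only [Measure.coe_finsetSum, Finset.sum_apply, Measure.smul_apply, hof, smul_eq_mul,
    Measure.dirac_apply' _ hE, Set.indicator_apply, Pi.one_apply, mul_ite, mul_one, mul_zero]

lemma integral_sum_smul_dirac (σ : ℝ →₀ ℝ) (hσ : ∀ x, 0 ≤ σ x) (f : ℝ → ℝ) :
    ∫ x, f x ∂(∑ x ∈ σ.support, ENNReal.ofReal (σ x) • Measure.dirac x) =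
      Finsupp.linearCombination ℝ f σ := by
  rw [integral_finsetSum_measure fun x _ =>
    (integrable_dirac (by simp)).smul_measure ENNReal.ofReal_ne_top, Finsupp.linearCombination_apply,
    Finsupp.sum]
  refine Finset.sum_congr rfl fun x _ => ?_
  rw [integral_smul_measure, integral_dirac, ENNReal.toReal_ofReal (hσ x)]

/-- The point masses of a design, as a finitely supported function. -/
def weights (A B : ℝ) (ξ : Measure ℝ) : ℝ →₀ ℝ :=
  open Classical in if h : IsDesign A B ξ then h.exists_weights.choose else 0

namespace IsDesign

variable {A B : ℝ} {ξ ζ : Measure ℝ}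

lemma weights_apply (hξ : IsDesign A B ξ) (x : ℝ) : weights A B ξ x = ξ.real {x} := by
  rw [weights, dif_pos hξ]; exact hξ.exists_weights.choose_spec.1 x

lemma mem_Icc_of_mem_support (hξ : IsDesign A B ξ) {x : ℝ} (hx : x ∈ (weights A B ξ).support) :
    x ∈ Icc A B := by
  rw [weights, dif_pos hξ] at hx; exact hξ.exists_weights.choose_spec.2.1 x hx

lemma eq_sum_weights (hξ : IsDesign A B ξ) : ξ =
    ∑ x ∈ (weights A B ξ).support, ENNReal.ofReal (weights A B ξ x) • Measure.dirac x := by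
  have := hξ.exists_weights.choose_spec.2.2
  rw [weights, dif_pos hξ]; exact this

lemma weights_nonneg (hξ : IsDesign A B ξ) (x : ℝ) : 0 ≤ weights A B ξ x := by
  rw [hξ.weights_apply]; exact measureReal_nonneg

lemma integral_eq (hξ : IsDesign A B ξ) (f : ℝ → ℝ) :
    ∫ x, f x ∂ξ = Finsupp.linearCombination ℝ f (weights A B ξ) := by
  conv_lhs => rw [hξ.eq_sum_weights]
  exact integral_sum_smul_dirac _ hξ.weights_nonneg f

lemma ext_weights (hξ : IsDesign A B ξ) (hζ : IsDesign A B ζ)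
    (h : weights A B ξ = weights A B ζ) : ξ = ζ := by
  rw [hξ.eq_sum_weights, hζ.eq_sum_weights, h]

lemma supportPoints_eq (hξ : IsDesign A B ξ) :
    supportPoints ξ = ((weights A B ξ).support : Set ℝ) := by
  have := hξ.prob
  ext x
  simp [supportPoints, hξ.weights_apply, Measure.real, ENNReal.toReal_eq_zero_iff]

lemma linearCombination_one (hξ : IsDesign A B ξ) :
    Finsupp.linearCombination ℝ (fun _ => (1 : ℝ)) (weights A B ξ) = 1 := by
  have := hξ.prob
  rw [← hξ.integral_eq]; simp

lemma integral_congr (hξ : IsDesign A B ξ) {f g : ℝ → ℝ} (h : EqOn f g (Icc A B)) :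
    ∫ x, f x ∂ξ = ∫ x, g x ∂ξ := by
  rw [hξ.integral_eq, hξ.integral_eq, Finsupp.linearCombination_apply,
    Finsupp.linearCombination_apply]
  exact Finset.sum_congr rfl fun x hx => by simp only [h (hξ.mem_Icc_of_mem_support hx)]

end IsDesign

lemma exists_isDesign_of_weights {A B : ℝ} (σ : ℝ →₀ ℝ) (hσ : ∀ x, 0 ≤ σ x)
    (hI : ∀ x ∈ σ.support, x ∈ Icc A B)
    (h1 : Finsupp.linearCombination ℝ (fun _ => (1 : ℝ)) σ = 1) :
    ∃ ξ, IsDesign A B ξ ∧ ∀ f : ℝ → ℝ, ∫ x, f x ∂ξ = Finsupp.linearCombination ℝ f σ := by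
  refine ⟨∑ x ∈ σ.support, ENNReal.ofReal (σ x) • Measure.dirac x, ⟨⟨?_⟩, σ.support, hI, ?_⟩,
    integral_sum_smul_dirac σ hσ⟩
  · simp only [Measure.coe_finsetSum, Finset.sum_apply, Measure.smul_apply, measure_univ,
      smul_eq_mul, mul_one]
    rw [← ENNReal.ofReal_sum_of_nonneg fun x _ => hσ x]
    rw [Finsupp.linearCombination_apply, Finsupp.sum] at h1
    simpa using h1
  · rw [Measure.coe_finsetSum, Finset.sum_apply]
    refine Finset.sum_eq_zero fun x hx => ?_
    simp only [Measure.smul_apply, smul_eq_mul, mul_eq_zero]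
    right
    rw [Measure.dirac_apply' _ σ.support.measurableSet.compl]
    simpa using hx

/-- Among the designs that share the moments of `ξ` with respect to continuous functions
`u 0, …, u (k - 1)`, one maximizes the moment of `u k`. -/
lemma exists_maximal_design {A B : ℝ} {k : ℕ} (u : ℕ → ℝ → ℝ)
    (hu : ∀ i ≤ k, ContinuousOn (u i) (Icc A B)) {ξ : Measure ℝ} (hξ : IsDesign A B ξ) :
    ∃ ξt, IsDesign A B ξt ∧ (∀ i < k, ∫ x, u i x ∂ξt = ∫ x, u i x ∂ξ) ∧
      ∀ ζ, IsDesign A B ζ → (∀ i < k, ∫ x, u i x ∂ζ = ∫ x, u i x ∂ξ) →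
        ∫ x, u k x ∂ζ ≤ ∫ x, u k x ∂ξt := by
  let γ : ℝ → Fin (k + 1) → ℝ := fun x i => u i x
  let K := convexHull ℝ (γ '' Icc A B)
  have hK : IsCompact K := isCompact_convexHull_of_finiteDimensional
    (isCompact_Icc.image_of_continuousOn (continuousOn_pi.2 fun i => hu i (by omega)))
  have hmem : ∀ ζ, IsDesign A B ζ → (fun i : Fin (k + 1) => ∫ x, u i x ∂ζ) ∈ K := by
    intro ζ hζ
    have : (fun i : Fin (k + 1) => ∫ x, u i x ∂ζ) =
        ∑ x ∈ (weights A B ζ).support, weights A B ζ x • γ x := by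
      ext i
      rw [hζ.integral_eq, Finsupp.linearCombination_apply, Finsupp.sum]
      simp [γ]
    rw [this]
    refine (convex_convexHull ℝ _).sum_mem (fun x _ => hζ.weights_nonneg x) ?_
      fun x hx => subset_convexHull ℝ _ ⟨x, hζ.mem_Icc_of_mem_support hx, rfl⟩
    simpa [Finsupp.linearCombination_apply, Finsupp.sum] using hζ.linearCombination_one
  let L : Set (Fin (k + 1) → ℝ) := K ∩ {v | ∀ i : Fin (k + 1), (i : ℕ) < k → v i = ∫ x, u i x ∂ξ}
  have hL : IsCompact L := by
    refine hK.inter_right ?_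
    simp only [ofPred_forall]
    exact isClosed_iInter fun i => isClosed_iInter fun _ =>
      isClosed_eq (continuous_apply i) continuous_const
  obtain ⟨v, ⟨hvK, hv⟩, hmax⟩ := hL.exists_isMaxOn ⟨_, hmem ξ hξ, fun i _ => rfl⟩
    (continuous_apply (Fin.last k)).continuousOn
  obtain ⟨ι, _, w, z, hw, hw1, hz, hwz⟩ := mem_convexHull_iff_exists_fintype.1 hvK
  choose y hy hyz using hz
  -- The points `y i` need not be distinct; summing merges coinciding atoms.
  let σ : ℝ →₀ ℝ := ∑ i, Finsupp.single (y i) (w i)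
  obtain ⟨ξt, hξt, hint⟩ := exists_isDesign_of_weights (A := A) (B := B) σ
    (fun x => by
      classical
      simp only [σ, Finsupp.finsetSum_apply, Finsupp.single_apply]
      exact Finset.sum_nonneg fun i _ => by split_ifs <;> simp [hw])
    (fun x hx => by
      classical
      by_contra hcon
      refine Finsupp.mem_support_iff.1 hx ?_
      simp only [σ, Finsupp.finsetSum_apply, Finsupp.single_apply]
      refine Finset.sum_eq_zero fun i _ => if_neg fun (h : y i = x) => hcon (h ▸ hy i))
    (by simpa [σ, map_sum] using hw1)
  have hmom : ∀ i : Fin (k + 1), ∫ x, u i x ∂ξt = v i := fun i => by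
    rw [hint, ← hwz]
    simp [σ, map_sum, ← hyz, γ]
  refine ⟨ξt, hξt, fun i hi => ?_, fun ζ hζ hζm => ?_⟩
  · rw [← hv ⟨i, by omega⟩ hi, ← hmom]
  · have := hmax (⟨hmem ζ hζ, fun i hi => hζm i hi⟩ : _ ∈ L)
    have h2 := hmom (Fin.last k)
    simp only [Fin.val_last] at h2
    simpa [h2] using this

/-! ### Constant signs and counting arguments -/

/-- By Darboux's theorem the functions `w_0, …, w_k` have constant signs. -/
lemma exists_signs {A B : ℝ} {k : ℕ} {Ψ : ℕ → ℝ → ℝ}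
    (hΨ0 : ∀ x ∈ Icc A B, Ψ 0 x = 1) (hD : DerivativesExist A B k Ψ)
    (hF : ∀ x ∈ Icc A B, prodW A B k Ψ x ≠ 0) :
    ∃ s : ℕ → ℝ, (∀ j ≤ k, ∀ x ∈ Icc A B, 0 < s j * wFun A B Ψ j x) ∧
      ∀ x ∈ Icc A B, 0 < (∏ i ∈ Finset.range (k + 1), s i) * prodW A B k Ψ x := by
  have hsign : ∀ j, ∃ r : ℝ, j ≤ k → ∀ x ∈ Icc A B, 0 < r * wFun A B Ψ j x := by
    intro j
    rcases j with _ | j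
    · exact ⟨1, fun _ x hx => by simp [wFun, iterD, hΨ0 x hx]⟩
    by_cases hj : j + 1 ≤ k
    swap
    · exact ⟨0, fun h => absurd h hj⟩
    have hne : ∀ x ∈ Icc A B, wFun A B Ψ (j + 1) x ≠ 0 := fun x hx =>
      Finset.prod_ne_zero_iff.1 (hF x hx) (j + 1) (by simp; omega)
    rcases hasDerivWithinAt_forall_lt_or_forall_gt_of_forall_ne (convex_Icc A B)
      (fun x hx => (hD j (by omega) j le_rfl x hx).hasDerivWithinAt) hne with h | h
    · exact ⟨-1, fun _ x hx => by rw [neg_one_mul, neg_pos]; exact h x hx⟩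
    · exact ⟨1, fun _ x hx => by rw [one_mul]; exact h x hx⟩
  choose s hs using hsign
  refine ⟨s, hs, fun x hx => ?_⟩
  have h0 : prodW A B k Ψ x = ∏ i ∈ Finset.range (k + 1), wFun A B Ψ i x := by
    rw [Finset.prod_range_succ', prodW,
      show Finset.Icc 1 k = Finset.Ico 1 (k + 1) by ext; simp,
      Finset.prod_Ico_eq_prod_range]
    simp [wFun, iterD, hΨ0 x hx, add_comm 1]
  rw [h0, ← Finset.prod_mul_distrib]
  exact Finset.prod_pos fun i hi => hs i (by simp at hi; omega) x hx

/-- The cardinalities related to a finite set and two marked points. -/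
lemma exists_card_decomposition (S : Finset ℝ) {A B : ℝ} (hAB : A ≠ B) :
    ∃ a α β : ℕ, α ≤ 1 ∧ β ≤ 1 ∧ (α = 1 ↔ A ∈ S) ∧ (β = 1 ↔ B ∈ S) ∧ S.card = a + α + β ∧
      (insert A S).card = a + 1 + β ∧ (insert B S).card = a + α + 1 ∧
      (insert A (insert B S)).card = a + 2 ∧ ((S.erase A).erase B).card = a ∧
      (S.erase A).card = a + β ∧ (S.erase B).card = a + α ∧
      (((S : Set ℝ) \ {A, B}).ncard : ℝ) + (((S : Set ℝ) ∩ {A, B}).ncard : ℝ) / 2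
        = a + (α + β : ℝ) / 2 := by
  classical
  obtain ⟨R, hA, hB, hS⟩ : ∃ R : Finset ℝ, A ∉ R ∧ B ∉ R ∧ (S.erase A).erase B = R :=
    ⟨_, by simp, by simp, rfl⟩
  have hd : (S : Set ℝ) \ {A, B} = (R : Set ℝ) := by
    ext x; simp [← hS]; tauto
  have hi : ∀ U : Finset ℝ, (∀ x, x ∈ U ↔ x ∈ S ∧ (x = A ∨ x = B)) →
      ((S : Set ℝ) ∩ {A, B}).ncard = U.card := fun U hU => by
    rw [← Set.ncard_coe_finset]; congr 1; ext x; simp [hU]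
  rw [hd, Set.ncard_coe_finset]
  by_cases h1 : A ∈ S <;> by_cases h2 : B ∈ S
  · have h : S = insert A (insert B R) := by
      ext x; simp [← hS]; by_cases x = A <;> by_cases x = B <;> simp_all
    refine ⟨R.card, 1, 1, le_rfl, le_rfl, by simp [h1], by simp [h2], ?_⟩
    rw [hi {A, B} (fun x => by simp; rintro (rfl | rfl) <;> assumption)]
    rw [h]
    simp [hAB, hAB.symm, hA, hB, Finset.erase_insert_of_ne]
  · have h : S = insert A R := by
      ext x; simp [← hS]; by_cases x = A <;> by_cases x = B <;> simp_all
    refine ⟨R.card, 1, 0, le_rfl, by simp, by simp [h1], by simp [h2], ?_⟩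
    rw [hi {A} (fun x => by
      simp; constructor
      · rintro rfl; exact ⟨h1, Or.inl rfl⟩
      · rintro ⟨h, rfl | rfl⟩
        · rfl
        · exact absurd h h2)]
    rw [h]
    simp [hAB, hAB.symm, hA, hB, Finset.insert_comm B A]
  · have h : S = insert B R := by
      ext x; simp [← hS]; by_cases x = A <;> by_cases x = B <;> simp_all
    refine ⟨R.card, 0, 1, by simp, le_rfl, by simp [h1], by simp [h2], ?_⟩
    rw [hi {B} (fun x => by
      simp; constructor
      · rintro rfl; exact ⟨h2, Or.inr rfl⟩
      · rintro ⟨h, rfl | rfl⟩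
        · exact absurd h h1
        · rfl)]
    rw [h]
    simp [hAB, hA, hB]
  · have h : S = R := by
      ext x; simp [← hS]; by_cases x = A <;> by_cases x = B <;> simp_all
    refine ⟨R.card, 0, 0, by simp, by simp, by simp [h1], by simp [h2], ?_⟩
    rw [hi ∅ (fun x => by
      simp; intro h; constructor <;> rintro rfl <;> contradiction)]
    rw [h]
    simp [hAB, hA, hB]

/-- Points of a finite set interlaced with midpoints of consecutive points. -/
lemma exists_interlaced (T : Finset ℝ) {A B : ℝ} (hT : ∀ x ∈ T, x ∈ Icc A B) (m : ℕ)
    (hm : m + 1 ≤ T.card) :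
    ∃ z : ℕ → ℝ, (∀ n < 2 * m, z n < z (n + 1)) ∧ (∀ n ≤ 2 * m, z n ∈ Icc A B) ∧
      ∀ i ≤ m, z (2 * i) ∈ T := by
  obtain ⟨U, hU, hUc⟩ := Finset.exists_subset_card_eq hm
  let Y : ℕ → ℝ := fun n => if h : n < m + 1 then U.orderEmbOfFin hUc ⟨n, h⟩ else 0
  have hY : ∀ n ≤ m, Y n ∈ T := fun n hn => by
    simp only [Y, dif_pos (Nat.lt_succ_of_le hn)]
    exact hU (Finset.orderEmbOfFin_mem _ _ _)
  have hlt : ∀ n < m, Y n < Y (n + 1) := fun n hn => by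
    simp only [Y, dif_pos (show n < m + 1 by omega), dif_pos (show n + 1 < m + 1 by omega)]
    exact (U.orderEmbOfFin hUc).strictMono (by simp [Fin.lt_def])
  -- Both floors agree for even `n`, giving a point of `T`; for odd `n` the value is the midpoint of
  -- its neighbours.
  refine ⟨fun n => (Y (n / 2) + Y ((n + 1) / 2)) / 2, fun n hn => ?_, fun n hn => ?_,
    fun i hi => ?_⟩
  · have := hlt (n / 2) (by omega)
    beta_reduce
    rw [show (n + 1 + 1) / 2 = n / 2 + 1 by omega]
    linarith
  · have h1 := hT _ (hY (n / 2) (by omega))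
    have h2 := hT _ (hY ((n + 1) / 2) (by omega))
    exact ⟨by linarith [h1.1, h2.1], by linarith [h1.2, h2.2]⟩
  · have : (Y (2 * i / 2) + Y ((2 * i + 1) / 2)) / 2 = Y i := by
      rw [show 2 * i / 2 = i by omega, show (2 * i + 1) / 2 = i by omega]; ring
    beta_reduce
    rw [this]
    exact hY i hi

/-- Converts a sign pattern into a count: every second point, from position `r` on, is distinct from
the others. -/
lemma le_card_of_strictMono {k N r : ℕ} {x : Fin (k + 1) → ℝ} (hx : StrictMono x)
    (U : Finset ℝ) (hN : ∀ i < N, 2 * i + r < k + 1)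
    (hU : ∀ i (hi : i < N), x ⟨2 * i + r, hN i hi⟩ ∈ U) : N ≤ U.card := by
  have := Finset.card_le_card_of_injOn (s := (Finset.univ : Finset (Fin N))) (t := U)
    (fun i => x ⟨2 * i + r, hN i i.2⟩) (fun i _ => hU i i.2)
    (fun i _ j _ h => by
      have := hx.injective h
      simp only [Fin.mk.injEq] at this
      ext; omega)
  simpa using this

/-! ### Lower and upper bounds for the index -/

section Extremal

variable {A B : ℝ} {k : ℕ} {Ψ : ℕ → ℝ → ℝ} {s : ℕ → ℝ}

/-- A design whose index is less than `k / 2` is determined by its moments. -/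
lemma le_index_of_ne (hD : DerivativesExist A B k Ψ) (hk : 1 ≤ k) (hAB : A < B)
    (hs : ∀ j ≤ k, ∀ x ∈ Icc A B, 0 < s j * wFun A B Ψ j x) {ξ ζ : Measure ℝ}
    (hξ : IsDesign A B ξ) (hζ : IsDesign A B ζ)
    (hm : ∀ i < k, ∫ x, Ψ i x ∂ζ = ∫ x, Ψ i x ∂ξ) (hne : ζ ≠ ξ) :
    (k : ℝ) / 2 ≤ index A B ξ := by
  classical
  obtain ⟨x, hx, hxI, hpat⟩ := exists_sign_changes hD hk s hs _
    (weights A B ζ - weights A B ξ) le_rfl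
    (fun y hy => by
      rcases Finset.mem_union.1 (Finsupp.support_sub hy) with h | h
      · exact hζ.mem_Icc_of_mem_support h
      · exact hξ.mem_Icc_of_mem_support h)
    (fun h => hne (hζ.ext_weights hξ (sub_eq_zero.1 h)))
    (fun i hi => by rw [map_sub, ← hζ.integral_eq, ← hξ.integral_eq, hm i hi, sub_self])
  set S := (weights A B ξ).support with hS
  have hmem : ∀ j, weights A B ζ (x j) - weights A B ξ (x j) < 0 → x j ∈ S := fun j hj => by
    rw [hS, Finsupp.mem_support_iff]
    intro h
    linarith [hζ.weights_nonneg (x j)]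
  -- Only the first point can be `A` and only the last can be `B`; discarding unusable end points
  -- from the support sharpens the count to the index.
  have hnA : ∀ j : Fin (k + 1), 0 < (j : ℕ) → x j ≠ A := fun j hj h => by
    have := hx (show (0 : Fin (k + 1)) < j from hj)
    linarith [(hxI 0).1]
  have hnB : ∀ j : Fin (k + 1), (j : ℕ) < k → x j ≠ B := fun j hj h => by
    have := hx (show j < Fin.last k from hj)
    linarith [(hxI (Fin.last k)).2]
  obtain ⟨a, α, β, hα, hβ, -, -, hc, -, -, -, hcAB, hcA, hcB, hind⟩ :=
    exists_card_decomposition S hAB.ne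
  rw [index, hξ.supportPoints_eq, hind]
  suffices h : k ≤ 2 * a + α + β by
    have : (k : ℝ) ≤ 2 * a + α + β := by exact_mod_cast h
    linarith
  rcases hpat with hpat | hpat
  · have hodd : ∀ i (hi : 2 * i + 1 < k + 1), x ⟨2 * i + 1, hi⟩ ∈ S := fun i hi => by
      refine hmem _ ?_
      have := hpat ⟨2 * i + 1, hi⟩
      simpa [pow_succ, pow_mul] using this
    rcases Nat.even_or_odd' k with ⟨m, rfl | rfl⟩
    · have := le_card_of_strictMono (N := m) (r := 1) hx ((S.erase A).erase B)
        (fun i hi => by omega) (fun i hi => Finset.mem_erase.2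
          ⟨hnB _ (by simp; omega), Finset.mem_erase.2 ⟨hnA _ (by simp), hodd i _⟩⟩)
      omega
    · have := le_card_of_strictMono (N := m + 1) (r := 1) hx (S.erase A)
        (fun i hi => by omega) (fun i hi => Finset.mem_erase.2 ⟨hnA _ (by simp), hodd i _⟩)
      omega
  · have heven : ∀ i (hi : 2 * i + 0 < k + 1), x ⟨2 * i + 0, hi⟩ ∈ S := fun i hi => by
      refine hmem _ ?_
      have := hpat ⟨2 * i + 0, hi⟩
      simpa [pow_mul] using this
    rcases Nat.even_or_odd' k with ⟨m, rfl | rfl⟩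
    · have := le_card_of_strictMono (N := m + 1) (r := 0) hx S
        (fun i hi => by omega) (fun i hi => heven i _)
      omega
    · have := le_card_of_strictMono (N := m + 1) (r := 0) hx (S.erase B)
        (fun i hi => by omega) (fun i hi => Finset.mem_erase.2 ⟨hnB _ (by simp; omega), heven i _⟩)
      omega

/-- Exchange argument: the support of a maximal design does not contain the points of negative
weight of an alternating annihilator. -/
lemma exists_notMem_support_of_maximal (hD : DerivativesExist A B k Ψ) (hk : 1 ≤ k)
    (hΨ0 : ∀ x ∈ Icc A B, Ψ 0 x = 1)
    (hs : ∀ j ≤ k, ∀ x ∈ Icc A B, 0 < s j * wFun A B Ψ j x) {ξ : Measure ℝ}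
    (hξ : IsDesign A B ξ)
    (hmax : ∀ ζ, IsDesign A B ζ → (∀ i < k, ∫ x, Ψ i x ∂ζ = ∫ x, Ψ i x ∂ξ) →
      ∫ x, Ψ k x ∂ζ ≤ ∫ x, Ψ k x ∂ξ)
    (x : Fin (k + 1) → ℝ) (hx : StrictMono x) (hxI : ∀ j, x j ∈ Icc A B) :
    ∃ j : Fin (k + 1), (-1) ^ ((j : ℕ) + k) * (∏ i ∈ Finset.range (k + 1), s i) < 0 ∧
      x j ∉ (weights A B ξ).support := by
  classical
  by_contra! hcon
  obtain ⟨τ, hτ, hτ0, hτk⟩ := exists_alternating_weights hD hk s hs x hx hxI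
  let ρ : ℝ →₀ ℝ := ∑ j, Finsupp.single (x j) (τ j)
  have hρ : ∀ f : ℝ → ℝ, Finsupp.linearCombination ℝ f ρ = ∑ j, τ j * f (x j) := fun f => by
    simp [ρ, map_sum]
  have hρx : ∀ j, ρ (x j) = τ j := fun j => by
    simp [ρ, Finsupp.finsetSum_apply, Finsupp.single_apply, hx.injective.eq_iff]
  have hρ0 : ∀ y, (∀ j, x j ≠ y) → ρ y = 0 := fun y hy => by
    simp [ρ, Finsupp.finsetSum_apply, hy]
  have hpos : ∀ j, τ j < 0 → 0 < weights A B ξ (x j) := fun j hj => by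
    refine lt_of_le_of_ne (hξ.weights_nonneg _) (Ne.symm ?_)
    refine Finsupp.mem_support_iff.1 (hcon j ?_)
    have := hτ j
    by_contra h
    push Not at h
    nlinarith
  have hev : ∀ᶠ ε : ℝ in nhdsWithin 0 (Ioi 0), ∀ j, 0 ≤ weights A B ξ (x j) + ε * τ j := by
    rw [Filter.eventually_all]
    intro j
    rcases le_or_gt 0 (τ j) with h | h
    · filter_upwards [self_mem_nhdsWithin] with ε hε
      exact add_nonneg (hξ.weights_nonneg _) (mul_nonneg (le_of_lt hε) h)
    · have hcont : Filter.Tendsto (fun ε : ℝ => weights A B ξ (x j) + ε * τ j) (nhds 0)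
          (nhds (weights A B ξ (x j) + 0 * τ j)) := by
        apply Continuous.tendsto; fun_prop
      have h1 := hcont.eventually (lt_mem_nhds (a := 0) (by simpa using hpos j h))
      filter_upwards [nhdsWithin_le_nhds h1] with ε hε
      exact hε.le
  obtain ⟨ε, hε, hε0⟩ := (hev.and self_mem_nhdsWithin).exists
  have hε0 : 0 < ε := hε0
  -- Since `Ψ 0 = 1` is among the annihilated functions, the perturbation preserves total mass.
  have hone : Finsupp.linearCombination ℝ (fun _ => (1 : ℝ)) ρ = 0 := by
    rw [hρ, ← hτ0 0 hk]
    exact Finset.sum_congr rfl fun j _ => by rw [hΨ0 _ (hxI j)]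
  obtain ⟨ζ, hζ, hint⟩ := exists_isDesign_of_weights (A := A) (B := B) (weights A B ξ + ε • ρ)
    (fun y => by
      by_cases hy : ∃ j, x j = y
      · obtain ⟨j, rfl⟩ := hy
        simpa [hρx] using hε j
      · push Not at hy
        simpa [hρ0 y hy] using hξ.weights_nonneg y)
    (fun y hy => by
      by_cases hy' : ∃ j, x j = y
      · obtain ⟨j, rfl⟩ := hy'
        exact hxI j
      · push Not at hy'
        refine hξ.mem_Icc_of_mem_support (Finsupp.mem_support_iff.2 ?_)
        simpa [hρ0 y hy'] using hy)
    (by rw [map_add, map_smul, hone, hξ.linearCombination_one]; simp)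
  have hmom : ∀ f : ℝ → ℝ, ∫ x, f x ∂ζ = ∫ x, f x ∂ξ + ε * ∑ j, τ j * f (x j) := fun f => by
    rw [hint, map_add, map_smul, hρ, ← hξ.integral_eq, smul_eq_mul]
  have := hmax ζ hζ fun i hi => by rw [hmom, hτ0 i hi, mul_zero, add_zero]
  rw [hmom] at this
  nlinarith [mul_pos hε0 hτk]

/-- Upper bound for the number of support points of a maximal design, possibly together with
the end points `A` (for `r = 1`) and `B` (for `r + k < 2 m`). -/
lemma card_le_of_maximal (hD : DerivativesExist A B k Ψ) (hk : 1 ≤ k)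
    (hΨ0 : ∀ x ∈ Icc A B, Ψ 0 x = 1)
    (hs : ∀ j ≤ k, ∀ x ∈ Icc A B, 0 < s j * wFun A B Ψ j x) {ξ : Measure ℝ}
    (hξ : IsDesign A B ξ)
    (hmax : ∀ ζ, IsDesign A B ζ → (∀ i < k, ∫ x, Ψ i x ∂ζ = ∫ x, Ψ i x ∂ξ) →
      ∫ x, Ψ k x ∂ζ ≤ ∫ x, Ψ k x ∂ξ)
    (r m : ℕ) (hr : r + k ≤ 2 * m) (T : Finset ℝ) (hTI : ∀ y ∈ T, y ∈ Icc A B)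
    (hT : ∀ y ∈ T, y ∈ (weights A B ξ).support ∨ (r = 1 ∧ y = A) ∨ (r + k < 2 * m ∧ y = B))
    (hsign : ∀ j : ℕ, (-1) ^ (j + k) * (∏ i ∈ Finset.range (k + 1), s i) < 0 → Even (j + r)) :
    T.card ≤ m := by
  by_contra! hcard
  obtain ⟨z, hz, hzI, hzT⟩ := exists_interlaced T hTI m hcard
  have hzlt : ∀ n n', n < n' → n' ≤ 2 * m → z n < z n' := by
    intro n n' hn
    induction n', hn using Nat.le_induction with
    | base => exact fun h => hz n (by omega)
    | succ n' hn ih => exact fun h => (ih (by omega)).trans (hz n' (by omega))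
  -- The window of `k + 1` points starts at `z r`, so that negative weights fall on even indices,
  -- that is, on points of `T`.
  obtain ⟨j, hj, hjS⟩ := exists_notMem_support_of_maximal hD hk hΨ0 hs hξ hmax
    (fun j => z (j + r)) (fun i j hij => hzlt _ _ (by simpa using hij) (by omega))
    (fun j => hzI _ (by omega))
  obtain ⟨i, hi⟩ := hsign j hj
  have hi' : (j : ℕ) + r = 2 * i := by omega
  have hjk := j.2
  -- An added end point cannot occur in the window: for `r = 1` it omits `z 0`, and for `r + k < 2
  -- m` it omits `z (2 m)`.
  rcases hT _ (hzT i (by omega)) with h | ⟨h1, h⟩ | ⟨h1, h⟩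
  · exact hjS (by simpa [hi'] using h)
  · have := hzlt 0 (2 * i) (by omega) (by omega)
    linarith [(hzI 0 (by omega)).1]
  · have := hzlt (2 * i) (2 * m) (by omega) le_rfl
    linarith [(hzI (2 * m) le_rfl).2]

end Extremal


/-! ### Loewner comparison and the main theorem -/

/-- Designs with equal moments of `Ψ 0, …, Ψ (k - 1)` have information matrices ordered by their
moments of `Ψ k`. -/
lemma infoMatrix_sub_posSemidef {p k : ℕ} {A B : ℝ} {Θ : Set (EuclideanSpace ℝ (Fin p))}
    {η : ℝ → EuclideanSpace ℝ (Fin p) → ℝ} {θ : EuclideanSpace ℝ (Fin p)}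
    {P : Matrix (Fin p) (Fin p) ℝ} {Ψm : Fin p → Fin p → ℝ → ℝ}
    (hrep : ∀ ξ : Measure ℝ, IsDesign A B ξ →
      infoMatrix Θ η θ ξ = P * momentMatrix Ψm ξ * P.transpose)
    {Ψ : ℕ → ℝ → ℝ} (hΨ : IsListOfNonconstantEntries A B k Ψ Ψm)
    (hdef : LastIsDiagonal A B k Ψ Ψm) {ξ ζ : Measure ℝ}
    (hξ : IsDesign A B ξ) (hζ : IsDesign A B ζ)
    (hm : ∀ i < k, ∫ x, Ψ i x ∂ζ = ∫ x, Ψ i x ∂ξ)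
    (hk : ∫ x, Ψ k x ∂ξ ≤ ∫ x, Ψ k x ∂ζ) :
    (infoMatrix Θ η θ ζ - infoMatrix Θ η θ ξ).PosSemidef := by
  obtain ⟨l, hl, hother⟩ := hdef
  -- Every other entry is constant or equals some `Ψ m` with `m < k`, so its moment is the same for
  -- both designs.
  have hdiag : momentMatrix Ψm ζ - momentMatrix Ψm ξ =
      Matrix.diagonal (Pi.single l (∫ x, Ψ k x ∂ζ - ∫ x, Ψ k x ∂ξ)) := by
    ext i j
    simp only [momentMatrix, Matrix.sub_apply, Matrix.of_apply]
    by_cases hij : (i, j) = (l, l)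
    · obtain ⟨rfl, rfl⟩ := Prod.mk.inj hij
      simp [hζ.integral_congr hl, hξ.integral_congr hl]
    · have hzero : Matrix.diagonal (Pi.single l (∫ x, Ψ k x ∂ζ - ∫ x, Ψ k x ∂ξ)) i j
          = (0 : ℝ) := by
        by_cases h : i = j
        · subst h
          have : i ≠ l := fun h => hij (by simp [h])
          simp [this]
        · simp [h]
      rw [hzero, sub_eq_zero]
      by_cases hc : IsConstOn (Ψm i j) (Icc A B)
      · obtain ⟨c, hc⟩ := hc
        have := hξ.prob
        have := hζ.prob
        rw [hζ.integral_congr (g := fun _ => c) hc, hξ.integral_congr (g := fun _ => c) hc]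
        simp
      · obtain ⟨m, hmk, hmE⟩ := hΨ.exhaust i j hc
        have hlt : m < k := lt_of_le_of_ne hmk.2 fun h => hother i j hij (h ▸ hmE)
        rw [hζ.integral_congr hmE, hξ.integral_congr hmE, hm m hlt]
  rw [hrep ζ hζ, hrep ξ hξ, ← Matrix.sub_mul, ← Matrix.mul_sub, hdiag]
  have := (Matrix.PosSemidef.diagonal (n := Fin p) (R := ℝ)
    (d := Pi.single l (∫ x, Ψ k x ∂ζ - ∫ x, Ψ k x ∂ξ))
    (Pi.single_nonneg.2 (sub_nonneg.2 hk))).mul_mul_conjTranspose_same P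
  simpa [Matrix.conjTranspose_eq_transpose_of_trivial] using this

end OptimalDesign

end

open OptimalDesign in
theorem theorem3p4
    (p k : ℕ) (hk : 1 ≤ k) (A B : ℝ) (hAB : A < B)
    -- the regression model, at a fixed parameter `θ`
    (Θ : Set (EuclideanSpace ℝ (Fin p))) (η : ℝ → EuclideanSpace ℝ (Fin p) → ℝ)
    (hηcont : ContinuousOn (fun q : ℝ × EuclideanSpace ℝ (Fin p) => η q.1 q.2)
      (Set.Icc A B ×ˢ Θ))
    (hηdiff : ∀ x ∈ Set.Icc A B, DifferentiableOn ℝ (η x) Θ)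
    (θ : EuclideanSpace ℝ (Fin p)) (hθ : θ ∈ Θ)
    -- the representation `M(ξ, θ) = P C(ξ) Pᵀ`, with `P` nonsingular and independent of `ξ`
    (P : Matrix (Fin p) (Fin p) ℝ) (hP : IsUnit P.det)
    (Ψm : Fin p → Fin p → ℝ → ℝ)
    (hrep : ∀ ξ : MeasureTheory.Measure ℝ, OptimalDesign.IsDesign A B ξ →
      OptimalDesign.infoMatrix Θ η θ ξ
        = P * OptimalDesign.momentMatrix Ψm ξ * P.transpose)
    -- `Ψ 0 = 1`, and `Ψ 1, …, Ψ k` are the different nonconstant entries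
    (Ψ : ℕ → ℝ → ℝ) (hΨ0 : ∀ x ∈ Set.Icc A B, Ψ 0 x = 1)
    (hΨ : OptimalDesign.IsListOfNonconstantEntries A B k Ψ Ψm)
    (hdef : OptimalDesign.LastIsDiagonal A B k Ψ Ψm)
    (hsmooth : ∀ j ∈ Set.Icc 1 k,
      ContDiffOn ℝ ((j + 1 : ℕ) : WithTop ℕ∞) (Ψ j) (Set.Icc A B))
    (hD : OptimalDesign.DerivativesExist A B k Ψ)
    (hF : ∀ x ∈ Set.Icc A B, OptimalDesign.prodW A B k Ψ x ≠ 0)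
    (ξ : MeasureTheory.Measure ℝ) (hξ : OptimalDesign.IsDesign A B ξ) :
    ∃ ξt : MeasureTheory.Measure ℝ, OptimalDesign.IsDesign A B ξt ∧
      OptimalDesign.index A B ξt ≤ (k : ℝ) / 2 ∧
      (OptimalDesign.infoMatrix Θ η θ ξt - OptimalDesign.infoMatrix Θ η θ ξ).PosSemidef ∧
      (OptimalDesign.index A B ξ < (k : ℝ) / 2 →
        ξt = ξ ∧
        ∀ ζ : MeasureTheory.Measure ℝ, OptimalDesign.IsDesign A B ζ →
          (∀ i < k, ∫ x, Ψ i x ∂ζ = ∫ x, Ψ i x ∂ξ) → ζ = ξ) ∧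
      ((k : ℝ) / 2 ≤ OptimalDesign.index A B ξ →
        (Odd k → (∀ x ∈ Set.Icc A B, OptimalDesign.prodW A B k Ψ x < 0) →
          ((OptimalDesign.supportPoints ξt).ncard : ℝ) ≤ ((k : ℝ) + 1) / 2 ∧
          A ∈ OptimalDesign.supportPoints ξt) ∧
        (Odd k → (∀ x ∈ Set.Icc A B, 0 < OptimalDesign.prodW A B k Ψ x) →
          ((OptimalDesign.supportPoints ξt).ncard : ℝ) ≤ ((k : ℝ) + 1) / 2 ∧
          B ∈ OptimalDesign.supportPoints ξt) ∧
        (Even k → (∀ x ∈ Set.Icc A B, OptimalDesign.prodW A B k Ψ x < 0) →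
          ((OptimalDesign.supportPoints ξt).ncard : ℝ) ≤ (k : ℝ) / 2) ∧
        (Even k → (∀ x ∈ Set.Icc A B, 0 < OptimalDesign.prodW A B k Ψ x) →
          ((OptimalDesign.supportPoints ξt).ncard : ℝ) ≤ (k : ℝ) / 2 + 1 ∧
          A ∈ OptimalDesign.supportPoints ξt ∧
          B ∈ OptimalDesign.supportPoints ξt)) := by
  classical
  obtain ⟨s, hs, hsF⟩ := exists_signs hΨ0 hD hF
  by_cases hlow : index A B ξ < (k : ℝ) / 2
  · refine ⟨ξ, hξ, hlow.le, by simpa using Matrix.PosSemidef.zero, fun _ => ⟨rfl, ?_⟩,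
      fun h => absurd hlow h.not_gt⟩
    intro ζ hζ hm
    by_contra hne
    exact hlow.not_ge (le_index_of_ne hD hk hAB hs hξ hζ hm hne)
  push Not at hlow
  have hcont : ∀ i ≤ k, ContinuousOn (Ψ i) (Set.Icc A B) := fun i hi => by
    rcases i with _ | i
    · exact continuousOn_const.congr hΨ0
    · exact (hsmooth (i + 1) ⟨by omega, hi⟩).continuousOn
  obtain ⟨ξt, hξt, hm, hmax⟩ := exists_maximal_design Ψ hcont hξ
  have hmax' : ∀ ζ, IsDesign A B ζ → (∀ i < k, ∫ x, Ψ i x ∂ζ = ∫ x, Ψ i x ∂ξt) →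
      ∫ x, Ψ k x ∂ζ ≤ ∫ x, Ψ k x ∂ξt :=
    fun ζ hζ h => hmax ζ hζ fun i hi => (h i hi).trans (hm i hi)
  -- A maximizer other than `ξ` shares its moments with `ξ`, so it is not determined by them.
  have hidx : (k : ℝ) / 2 ≤ index A B ξt := by
    by_cases h : ξ = ξt
    · exact h ▸ hlow
    · exact le_index_of_ne hD hk hAB hs hξt hξ (fun i hi => (hm i hi).symm) h
  have hpsd := infoMatrix_sub_posSemidef hrep hΨ hdef hξ hξt hm (hmax ξ hξ fun _ _ => rfl)
  have hA : A ∈ Set.Icc A B := ⟨le_rfl, hAB.le⟩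
  have hB : B ∈ Set.Icc A B := ⟨hAB.le, le_rfl⟩
  have hSI : ∀ y ∈ (weights A B ξt).support, y ∈ Set.Icc A B :=
    fun y => hξt.mem_Icc_of_mem_support
  have hcard := card_le_of_maximal hD hk hΨ0 hs hξt hmax'
  have hsA := hsF A hA
  obtain ⟨a, α, β, hα, hβ, hαA, hβB, hc, hcA, hcB, hcAB, -, -, -, hind⟩ :=
    exists_card_decomposition (weights A B ξt).support hAB.ne
  have hncard : (supportPoints ξt).ncard = a + α + β := by
    rw [hξt.supportPoints_eq, Set.ncard_coe_finset, hc]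
  have hidx_eq : index A B ξt = (a : ℝ) + (α + β) / 2 := by
    rw [index, hξt.supportPoints_eq, hind]
  have hidx_nat : k ≤ 2 * a + α + β := by
    rw [hidx_eq] at hidx
    have : (k : ℝ) ≤ 2 * a + α + β := by linarith
    exact_mod_cast this
  have hAmem : α = 1 → A ∈ supportPoints ξt := fun h => by
    rw [hξt.supportPoints_eq]; exact hαA.1 h
  have hBmem : β = 1 → B ∈ supportPoints ξt := fun h => by
    rw [hξt.supportPoints_eq]; exact hβB.1 h
  set e := ∏ i ∈ Finset.range (k + 1), s i
  -- the parity of the points of negative weight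
  have hneg : prodW A B k Ψ A < 0 → ∀ j : ℕ, (-1) ^ (j + k) * e < 0 → Even (j + k) := by
    intro h j hj
    by_contra hodd
    rw [Nat.not_even_iff_odd] at hodd
    rw [hodd.neg_one_pow] at hj
    nlinarith
  have hpos : 0 < prodW A B k Ψ A → ∀ j : ℕ, (-1) ^ (j + k) * e < 0 → Odd (j + k) := by
    intro h j hj
    by_contra heven
    rw [Nat.not_odd_iff_even] at heven
    rw [heven.neg_one_pow] at hj
    nlinarith
  -- In the four bounds `r` has the parity making `j + r` even at negative weights. `A` may be added
  -- when `r = 1`, and `B` when the window ends before the last interlaced point.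
  have hodd_neg : ∀ m, k = 2 * m + 1 → prodW A B k Ψ A < 0 → a + 1 + β ≤ m + 1 := by
    intro m hkm h
    rw [← hcA]
    refine hcard 1 (m + 1) (by omega) _ (fun y hy => ?_) (fun y hy => ?_) fun j hj => ?_
    · rcases Finset.mem_insert.1 hy with rfl | hy
      exacts [hA, hSI y hy]
    · rcases Finset.mem_insert.1 hy with rfl | hy
      exacts [Or.inr (Or.inl ⟨rfl, rfl⟩), Or.inl hy]
    · have := hneg h j hj
      grind
  have hodd_pos : ∀ m, k = 2 * m + 1 → 0 < prodW A B k Ψ A → a + α + 1 ≤ m + 1 := by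
    intro m hkm h
    rw [← hcB]
    refine hcard 0 (m + 1) (by omega) _ (fun y hy => ?_) (fun y hy => ?_) fun j hj => ?_
    · rcases Finset.mem_insert.1 hy with rfl | hy
      exacts [hB, hSI y hy]
    · rcases Finset.mem_insert.1 hy with rfl | hy
      exacts [Or.inr (Or.inr ⟨by omega, rfl⟩), Or.inl hy]
    · have := hpos h j hj
      grind
  have heven_neg : ∀ m, k = 2 * m → prodW A B k Ψ A < 0 → a + α + β ≤ m := by
    intro m hkm h
    rw [← hc]
    refine hcard 0 m (by omega) _ hSI (fun y hy => Or.inl hy) fun j hj => ?_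
    have := hneg h j hj
    grind
  have heven_pos : ∀ m, k = 2 * m → 0 < prodW A B k Ψ A → a + 2 ≤ m + 1 := by
    intro m hkm h
    rw [← hcAB]
    refine hcard 1 (m + 1) (by omega) _ (fun y hy => ?_) (fun y hy => ?_) fun j hj => ?_
    · rcases Finset.mem_insert.1 hy with rfl | hy
      · exact hA
      rcases Finset.mem_insert.1 hy with rfl | hy
      exacts [hB, hSI y hy]
    · rcases Finset.mem_insert.1 hy with rfl | hy
      · exact Or.inr (Or.inl ⟨rfl, rfl⟩)
      rcases Finset.mem_insert.1 hy with rfl | hy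
      exacts [Or.inr (Or.inr ⟨by omega, rfl⟩), Or.inl hy]
    · have := hpos h j hj
      grind
  refine ⟨ξt, hξt, ?_, hpsd, fun h => absurd h hlow.not_gt, fun _ => ⟨?_, ?_, ?_, ?_⟩⟩
  · suffices h : 2 * a + α + β ≤ k by
      have : (2 * a + α + β : ℝ) ≤ k := by exact_mod_cast h
      rw [hidx_eq]; linarith
    rcases Nat.even_or_odd' k with ⟨m, hkm | hkm⟩ <;>
      rcases lt_or_gt_of_ne (hF A hA) with h | h
    · have := heven_neg m hkm h; omega
    · have := heven_pos m hkm h; omega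
    · have := hodd_neg m hkm h; omega
    · have := hodd_pos m hkm h; omega
  -- The upper bound counts the added end points as present; together with `k ≤ 2 a + α + β` it
  -- forces their indicators `α`, `β` to be one.
  · rintro ⟨m, hkm⟩ h
    have := hodd_neg m hkm (h A hA)
    refine ⟨?_, hAmem (by omega)⟩
    have h2 : ((a + α + β : ℕ) : ℝ) * 2 ≤ k + 1 := by exact_mod_cast (by omega)
    rw [hncard]; linarith
  · rintro ⟨m, hkm⟩ h
    have := hodd_pos m hkm (h A hA)
    refine ⟨?_, hBmem (by omega)⟩
    have h2 : ((a + α + β : ℕ) : ℝ) * 2 ≤ k + 1 := by exact_mod_cast (by omega)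
    rw [hncard]; linarith
  · intro hev h
    obtain ⟨m, hkm⟩ := even_iff_two_dvd.1 hev
    have := heven_neg m hkm (h A hA)
    have h2 : ((a + α + β : ℕ) : ℝ) * 2 ≤ k := by exact_mod_cast (by omega)
    rw [hncard]; linarith
  · intro hev h
    obtain ⟨m, hkm⟩ := even_iff_two_dvd.1 hev
    have := heven_pos m hkm (h A hA)
    refine ⟨?_, hAmem (by omega), hBmem (by omega)⟩
    have h2 : ((a + α + β : ℕ) : ℝ) * 2 ≤ k + 2 := by exact_mod_cast (by omega)
    rw [hncard]; linarith
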